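/- Let $\varphi:(0,\infty)\to[0,\infty)$ be a complete Bernstein function without killing and drift, i.e. $$\varphi(x)=\int_0^\infty (1-e^{-sx})\,\overline\nu(s)\,ds,\qquad x>0,$$ where $\overline\nu:(0,\infty)\to[0,\infty)$ is completely monotone and $\int_0^\infty (s\wedge 1)\overline\nu(s)\,ds<\infty$. Extend $\varphi$ to $\{z\in\mathbb C:\operatorname{Re} z\ge 0\}$ by $\varphi(z)=\int_0^\infty(1-e^{-sz})\,\overline\nu(s)\,ds$. Let $\kappa:(0,\infty)\to[0,\infty)$ be the associate Sonine kernel of $\varphi$, i.e. $\int_0^\infty e^{-\theta s}\kappa(s)\,ds=1/\varphi(\theta)$ (a finite integral, with $\varphi(\theta)\neq0$) for every $\theta>0$. Put $\chi(x)=\int_0^x\kappa(z)\,dz$ for $x\ge 0$, write $(x)_+=\max(x,0)$, and let $$(\mathcal I_-^{(\kappa)}f)(x)=\int_x^\infty f(t)\,\kappa(t-x)\,dt .$$ Suppose that for every $\varepsilon>0$ (B1) $\kappa\in L^1(0,\varepsilon)\cap L^2(\varepsilon,\infty)$, and (B2) $\chi\in L^2(0,\varepsilon)$. Let $a<b$ be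 real numbers. Then, for a.e. $x\in\mathbb R$, the integral defining $(\mathcal I_-^{(\kappa)}1_{(a,b)})(x)$ converges absolutely and $$(\mathcal I_-^{(\kappa)}1_{(a,b)})(x)=\chi((b-x)_+)-\chi((a-x)_+).$$ Moreover, with the convention $\mathcal F(\eta)(\xi)=\int_{\mathbb R}e^{i\xi x}\eta(x)\,dx$, the Fourier transform of $\mathcal I_-^{(\kappa)}1_{(a,b)}$ in the sense of tempered distributions is the function $$\mathcal F\big(\mathcal I_-^{(\kappa)}1_{(a,b)}\big)(\xi)=\varphi(i\xi)^{-1}\,\frac{e^{ib\xi}-e^{ia\xi}}{i\xi},$$ that is, for every Schwartz function $\eta:\mathbb R\to\mathbb C$, $$\int_{\mathbb R}(\mathcal I_-^{(\kappa)}1_{(a,b)})(x)\,\mathcal F(\eta)(x)\,dx=\int_{\mathbb R}\varphi(i\xi)^{-1}\frac{e^{ib\xi}-e^{ia\xi}}{i\xi}\,\eta(\xi)\,d\xi ,$$ where both functions have an absolutely convergent pairing with every Schwartz function. Finally, $\mathcal I_-^{(\kappa)}1_{(a,b)}\in L^2(\mathbb R)$. -/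

import Mathlib

open MeasureTheory Set
open scoped ContDiff SchwartzMap

noncomputable section

/-- `f` is completely monotone on `(0, ∞)`. -/
def IsCompletelyMonotone (f : ℝ → ℝ) : Prop :=
  ContDiffOn ℝ ∞ f (Ioi 0) ∧
    ∀ n : ℕ, ∀ x : ℝ, 0 < x → 0 ≤ (-1 : ℝ) ^ n * iteratedDeriv n f x

/-- `φ` is, on `(0, ∞)`, the complete Bernstein function with zero killing rate, zero drift and
(completely monotone) Lévy density `nuBar`. -/
structure IsCompleteBernstein (φ nuBar : ℝ → ℝ) : Prop where
  completelyMonotone : IsCompletelyMonotone nuBar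
  levy : IntegrableOn (fun s => min s 1 * nuBar s) (Ioi 0)
  repr : ∀ x : ℝ, 0 < x → φ x = ∫ s in Ioi (0 : ℝ), (1 - Real.exp (-(s * x))) * nuBar s

/-- The extension to the closed right half-plane `0 ≤ Re z` of the Bernstein function with Lévy
density `nuBar`. -/
def bernsteinExt (nuBar : ℝ → ℝ) (z : ℂ) : ℂ :=
  ∫ s in Ioi (0 : ℝ), (1 - Complex.exp (-(s * z))) * (nuBar s : ℂ)

/-- `κ ≥ 0` is the associate Sonine kernel of the Bernstein function `φ`: its Laplace transform
is `1 / φ` on `(0, ∞)`. The product form also says that `φ` does not vanish there. -/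
structure IsSonineKernel (φ κ : ℝ → ℝ) : Prop where
  nonneg : ∀ s : ℝ, 0 < s → 0 ≤ κ s
  integrable : ∀ θ : ℝ, 0 < θ → IntegrableOn (fun s => Real.exp (-(s * θ)) * κ s) (Ioi 0)
  laplace : ∀ θ : ℝ, 0 < θ → (∫ s in Ioi (0 : ℝ), Real.exp (-(s * θ)) * κ s) * φ θ = 1

/-- The primitive `χ(x) = ∫₀ˣ κ(z) dz`, used for `x ≥ 0`. -/
def kernelPrimitive (κ : ℝ → ℝ) (x : ℝ) : ℝ := ∫ z in (0 : ℝ)..x, κ z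

/-- The right-sided generalized fractional integral
`(I f)(x) = ∫ₓ^∞ f(t) κ(t - x) dt`. -/
def fracIntegral (κ f : ℝ → ℝ) (x : ℝ) : ℝ := ∫ t in Ioi x, f t * κ (t - x)

/-- The Fourier transform with the convention `∫ exp(iξx) η(x) dx`. -/
def charFourier (η : ℝ → ℂ) (ξ : ℝ) : ℂ := ∫ x : ℝ, Complex.exp (Complex.I * ξ * x) * η x

/-- `G` is the Fourier transform of `u` in the sense of tempered distributions: both functions
pair absolutely with test functions, and `⟨G, η⟩ = ⟨u, η̂⟩` for every Schwartz function `η`. -/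
def IsDistribFourier (u G : ℝ → ℂ) : Prop :=
  (∀ η : 𝓢(ℝ, ℂ), Integrable (fun x => u x * η x)) ∧
  (∀ η : 𝓢(ℝ, ℂ), Integrable (fun ξ => G ξ * η ξ)) ∧
    ∀ η : 𝓢(ℝ, ℂ), ∫ x : ℝ, u x * charFourier η x = ∫ ξ : ℝ, G ξ * η ξ

end

open Filter
open scoped Topology Convolution FourierTransform

/-! With `κ` extended by zero, the fractional integral of `1_(a,b)` is the correlation `∫ 1_(a,b)(t)
κ(t - x) dt`. A translation turns it into the increment of `χ`. It is in `L²` by Young's inequality: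
split `κ` at `1` into an `L¹` and an `L²` piece, the indicator being in both spaces.

Since `κ` need not be integrable, the Fourier formula is proved for the damped kernel `exp(-θs)
κ(s)`. There the convolution theorem applies, and the kernel contributes the Laplace transform of
`κ` at `θ + iξ`, which is `1/φ(θ + iξ)` by the identity theorem (`laplace_mul_bernsteinExt`). As `θ
→ 0`, positivity of `κ` gives domination by the undamped integral, hence `L²` convergence. On the
Fourier side `φ(θ + iξ) → φ(iξ) ≠ 0` for `ξ ≠ 0`. Plancherel makes the two limits agree a.e.
(`isDistribFourier_of_tendsto`), so the limit is also in `L²` and pairs with Schwartz functions. -/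

/-! ### Fourier transforms of `L²` limits -/

theorem fourier_toLp_ae_eq {f : ℝ → ℂ} (h1 : Integrable f) (h2 : MemLp f 2) :
    (𝓕 (h2.toLp f) : Lp ℂ 2 (volume : Measure ℝ)) =ᵐ[volume] 𝓕 f := by
  have hc : Continuous (𝓕 f) :=
    VectorFourier.fourierIntegral_continuous Real.continuous_fourierChar
      (by exact continuous_inner) h1
  refine ae_eq_of_integral_contDiff_smul_eq
    ((Lp.memLp _).locallyIntegrable (by norm_num)) hc.locallyIntegrable fun g hg hgs => ?_
  let η : 𝓢(ℝ, ℂ) := (hgs.comp_left (g := fun x : ℝ => (x : ℂ)) (by simp)).toSchwartzMap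
    (Complex.ofRealCLM.contDiff.comp hg)
  have hη : ∀ x, η x = (g x : ℂ) := fun x => rfl
  have key := congrArg (fun T => T η) (Lp.fourier_toTemperedDistribution_eq (h2.toLp f))
  simp only [TemperedDistribution.fourier_apply, Lp.toTemperedDistribution_apply] at key
  have e1 : ∫ x, g x • (𝓕 (h2.toLp f) : Lp ℂ 2 (volume : Measure ℝ)) x
      = ∫ x, (𝓕 η) x • (h2.toLp f) x := by
    rw [key]; rfl
  rw [e1]
  have e2 : ∫ x, (𝓕 η) x • (h2.toLp f) x = ∫ x, (𝓕 (η : ℝ → ℂ)) x • f x := by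
    refine integral_congr_ae ?_
    filter_upwards [h2.coeFn_toLp] with x hx
    rw [hx, SchwartzMap.fourier_coe]
  rw [e2]
  -- Self-adjointness of the integral transform matches the duality that defines the distributional
  -- one.
  have e3 := VectorFourier.integral_fourierIntegral_smul_eq_flip (L := innerₗ ℝ) (μ := volume)
    (ν := volume) Real.continuous_fourierChar continuous_inner η.integrable h1
  rw [flip_innerₗ] at e3
  refine e3.trans (integral_congr_ae (ae_of_all _ fun x => ?_))
  exact Complex.coe_smul (g x) (𝓕 f x)

theorem fourier_limit_ae_eq {f G : ℝ → ℂ} {F : ℕ → ℝ → ℂ} (hF1 : ∀ n, Integrable (F n))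
    (hF2 : ∀ n, MemLp (F n) 2) (hf : MemLp f 2)
    (hlim : Tendsto (fun n => eLpNorm (F n - f) 2 volume) atTop (𝓝 0))
    (hG : ∀ᵐ ξ, Tendsto (fun n => 𝓕 (F n) ξ) atTop (𝓝 (G ξ))) :
    G =ᵐ[volume] (𝓕 (hf.toLp f) : Lp ℂ 2 (volume : Measure ℝ)) := by
  have h1 : Tendsto (fun n => (hF2 n).toLp (F n)) atTop (𝓝 (hf.toLp f)) :=
    (Lp.tendsto_Lp_iff_tendsto_eLpNorm'' F hF2 f hf).2 hlim
  have h2 : Tendsto (fun n => (𝓕 ((hF2 n).toLp (F n)) : Lp ℂ 2 (volume : Measure ℝ))) atTop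
      (𝓝 (𝓕 (hf.toLp f))) :=
    ((Lp.fourierTransformₗᵢ ℝ ℂ).continuous.tendsto _).comp h1
  -- A subsequence suffices: the whole sequence already converges pointwise a.e. to `G`.
  obtain ⟨ns, hns, h3⟩ := (tendstoInMeasure_of_tendsto_Lp h2).exists_seq_tendsto_ae
  have h4 : ∀ᵐ ξ, ∀ n, (𝓕 ((hF2 n).toLp (F n)) : Lp ℂ 2 (volume : Measure ℝ)) ξ = 𝓕 (F n) ξ :=
    ae_all_iff.2 fun n => fourier_toLp_ae_eq (hF1 n) (hF2 n)
  filter_upwards [hG, h3, h4] with ξ a b c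
  simp only [c] at b
  exact tendsto_nhds_unique (a.comp hns.tendsto_atTop) b

theorem charFourier_eq_fourier (f : ℝ → ℂ) (ξ : ℝ) :
    charFourier f ξ = 𝓕 f (-ξ / (2 * Real.pi)) := by
  rw [charFourier, Real.fourier_real_eq_integral_exp_smul]
  congr 1; ext x
  rw [smul_eq_mul]
  congr 2
  have : (Real.pi : ℂ) ≠ 0 := by exact_mod_cast Real.pi_ne_zero
  push_cast
  field_simp

theorem quasiMeasurePreserving_const_mul {c : ℝ} (hc : c ≠ 0) :
    Measure.QuasiMeasurePreserving (fun x : ℝ => c * x) volume volume := by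
  refine ⟨by fun_prop, ?_⟩
  rw [show (fun x : ℝ => c * x) = (c * ·) from rfl, Real.map_volume_mul_left hc]
  exact Measure.smul_absolutelyContinuous

theorem MeasureTheory.MemLp.comp_const_mul {f : ℝ → ℂ} (hf : MemLp f 2) {c : ℝ} (hc : c ≠ 0) :
    MemLp (fun x => f (c * x)) 2 := by
  have hm : AEStronglyMeasurable (fun x => f (c * x)) volume :=
    hf.1.comp_quasiMeasurePreserving (quasiMeasurePreserving_const_mul hc)
  rw [memLp_two_iff_integrable_sq_norm hm]
  exact ((memLp_two_iff_integrable_sq_norm hf.1).1 hf).comp_mul_left' hc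

/-- The distributional Fourier transform of an `L²` function is the pointwise limit of the Fourier
transforms of integrable functions approximating it in `L²`. -/
theorem isDistribFourier_of_tendsto {f G : ℝ → ℂ} {F : ℕ → ℝ → ℂ} (hF1 : ∀ n, Integrable (F n))
    (hF2 : ∀ n, MemLp (F n) 2) (hf : MemLp f 2)
    (hlim : Tendsto (fun n => eLpNorm (F n - f) 2 volume) atTop (𝓝 0))
    (hG : ∀ᵐ ξ, Tendsto (fun n => charFourier (F n) ξ) atTop (𝓝 (G ξ))) :
    IsDistribFourier f G := by
  have hpi : (-(2 * Real.pi)) ≠ 0 := by simp [Real.pi_ne_zero]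
  have hG' : ∀ᵐ ξ, Tendsto (fun n => 𝓕 (F n) ξ) atTop (𝓝 (G (-(2 * Real.pi) * ξ))) := by
    filter_upwards [(quasiMeasurePreserving_const_mul hpi).ae hG] with ξ hξ
    have : -(-(2 * Real.pi) * ξ) / (2 * Real.pi) = ξ := by
      field_simp
    simpa only [charFourier_eq_fourier, this] using hξ
  have hae := fourier_limit_ae_eq hF1 hF2 hf hlim hG'
  have hG1 : MemLp (fun ξ => G (-(2 * Real.pi) * ξ)) 2 := (Lp.memLp _).ae_eq hae.symm
  -- Square integrability of `G` comes for free, since its rescaling is a.e. a Plancherel transform.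
  have hG2 : MemLp G 2 := by
    have := hG1.comp_const_mul (inv_ne_zero hpi)
    simpa only [mul_inv_cancel_left₀ hpi] using this
  have hpair : ∀ {g : ℝ → ℂ}, MemLp g 2 → ∀ η : 𝓢(ℝ, ℂ), Integrable (fun x => g x * η x) :=
    fun hg η => hg.integrable_mul (η.memLp 2)
  refine ⟨hpair hf, hpair hG2, fun η => ?_⟩
  let e : ℝ ≃L[ℝ] ℝ := ContinuousLinearEquiv.smulLeft (Units.mk0 _ hpi)
  -- The dilation by `-2π` and its Jacobian `2π` make `𝓕 η₁` equal to `charFourier η`.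
  let η₁ : 𝓢(ℝ, ℂ) := ((2 * Real.pi : ℝ) : ℂ) •
    SchwartzMap.compCLMOfContinuousLinearEquiv ℂ e η
  have hη₁ : ∀ x, η₁ x = ((2 * Real.pi : ℝ) : ℂ) * η (-(2 * Real.pi) * x) := fun x => rfl
  have habs : |(-(2 * Real.pi))⁻¹| = (2 * Real.pi)⁻¹ := by
    rw [abs_inv, abs_neg, abs_of_pos (by positivity)]
  have hpi' : ((2 * Real.pi : ℝ) : ℂ) ≠ 0 := by
    exact_mod_cast (by positivity : (2 * Real.pi) ≠ 0)
  have hscale : ∀ h : ℝ → ℂ,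
      ∫ w, ((2 * Real.pi : ℝ) : ℂ) * h (-(2 * Real.pi) * w) = ∫ ξ, h ξ := by
    intro h
    rw [integral_const_mul, Measure.integral_comp_mul_left h, habs, Complex.real_smul]
    push_cast at hpi' ⊢
    field_simp
  have hchar : ∀ x, charFourier η x = 𝓕 (η₁ : ℝ → ℂ) x := by
    intro x
    rw [Real.fourier_real_eq_integral_exp_smul, charFourier,
      ← hscale (fun y => Complex.exp (Complex.I * x * y) * η y)]
    congr 1; ext y
    rw [hη₁, smul_eq_mul]
    push_cast
    have : Complex.I * x * (-(2 * Real.pi) * y) = -2 * Real.pi * y * x * Complex.I := by ring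
    rw [this]; ring
  have key := congrArg (fun T => T η₁) (Lp.fourier_toTemperedDistribution_eq (hf.toLp f))
  simp only [TemperedDistribution.fourier_apply, Lp.toTemperedDistribution_apply] at key
  calc ∫ x, f x * charFourier η x = ∫ x, (𝓕 η₁) x • (hf.toLp f) x := by
        refine integral_congr_ae ?_
        filter_upwards [hf.coeFn_toLp] with x hx
        rw [hx, hchar, SchwartzMap.fourier_coe, smul_eq_mul, mul_comm]
    _ = ∫ x, η₁ x • (𝓕 (hf.toLp f) : Lp ℂ 2 (volume : Measure ℝ)) x := key
    _ = ∫ w, ((2 * Real.pi : ℝ) : ℂ) *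
          (fun ξ => G ξ * η ξ) (-(2 * Real.pi) * w) := by
        refine integral_congr_ae ?_
        filter_upwards [hae] with w hw
        rw [← hw, hη₁, smul_eq_mul]; ring
    _ = ∫ ξ, G ξ * η ξ := hscale (fun ξ => G ξ * η ξ)

/-- Convergence in `L²` by domination. -/
theorem tendsto_eLpNorm_two_of_dominated {f : ℝ → ℂ} {F : ℕ → ℝ → ℂ}
    (hF : ∀ n, AEStronglyMeasurable (F n) volume) (hf : MemLp f 2)
    (hle : ∀ n, ∀ᵐ x, ‖F n x‖ ≤ ‖f x‖)
    (hlim : ∀ᵐ x, Tendsto (fun n => F n x) atTop (𝓝 (f x))) :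
    Tendsto (fun n => eLpNorm (F n - f) 2 volume) atTop (𝓝 0) := by
  have h2 : ∫⁻ x, (2 * ‖f x‖ₑ) ^ (2 : ℝ) ≠ ⊤ := by
    have := (hf.const_mul (2 : ℂ)).2
    rw [eLpNorm_lt_top_iff_lintegral_rpow_enorm_lt_top (by norm_num) (by norm_num)] at this
    refine ne_of_lt (lt_of_le_of_lt (lintegral_mono fun x => ?_) this)
    simp [← ofReal_norm]
  have h1 : Tendsto (fun n => ∫⁻ x, ‖(F n - f) x‖ₑ ^ (2 : ℝ)) atTop (𝓝 (∫⁻ _ : ℝ, 0)) := by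
    refine tendsto_lintegral_of_dominated_convergence' (fun x => (2 * ‖f x‖ₑ) ^ (2 : ℝ))
      (fun n => ((hF n).sub hf.1).enorm.pow_const _) (fun n => ?_) h2 ?_
    · filter_upwards [hle n] with x hx
      refine ENNReal.rpow_le_rpow ?_ (by norm_num)
      calc ‖F n x - f x‖ₑ ≤ ‖F n x‖ₑ + ‖f x‖ₑ := enorm_sub_le
        _ ≤ ‖f x‖ₑ + ‖f x‖ₑ := by gcongr; exact enorm_le_iff_norm_le.2 hx
        _ = 2 * ‖f x‖ₑ := (two_mul _).symm
    · filter_upwards [hlim] with x hx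
      have h0 : Tendsto (fun n => ‖F n x - f x‖ₑ) atTop (𝓝 0) := by
        have := (hx.sub_const (f x)).enorm
        simpa using this
      have := (ENNReal.continuous_rpow_const (y := 2)).tendsto 0 |>.comp h0
      simpa [Function.comp_def] using this
  simp only [lintegral_zero] at h1
  have h3 := (ENNReal.continuous_rpow_const (y := 1 / 2)).tendsto 0 |>.comp h1
  simp only [eLpNorm_eq_lintegral_rpow_enorm_toReal (two_ne_zero : (2 : ENNReal) ≠ 0)
    ENNReal.ofNat_ne_top]
  simpa [Function.comp_def] using h3

/-! ### Young's inequality -/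

/-- The square form of Young's inequality for the convolution of `L¹` and `L²` functions. -/
theorem lintegral_sq_lintegral_mul_le {f g : ℝ → ENNReal} (hf : Measurable f) (hg : Measurable g) :
    ∫⁻ x, (∫⁻ t, f t * g (t - x)) ^ 2 ≤ (∫⁻ t, f t) ^ 2 * ∫⁻ s, g s ^ 2 := by
  -- Cauchy–Schwarz for the measure `f dt`, applied to `1` and `g(t - x)`; Tonelli then finishes.
  have cs : ∀ x, (∫⁻ t, f t * g (t - x)) ^ 2 ≤ (∫⁻ t, f t) * ∫⁻ t, f t * g (t - x) ^ 2 := by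
    intro x
    have hm : Measurable fun t => g (t - x) := by fun_prop
    have h := ENNReal.lintegral_mul_le_Lp_mul_Lq (volume.withDensity f)
      Real.HolderConjugate.two_two (f := fun _ => 1) (g := fun t => g (t - x))
      (by fun_prop) hm.aemeasurable
    simp only [Pi.mul_apply, one_mul, ENNReal.one_rpow] at h
    rw [lintegral_withDensity_eq_lintegral_mul _ hf hm,
      lintegral_withDensity_eq_lintegral_mul _ hf measurable_const,
      lintegral_withDensity_eq_lintegral_mul _ hf (hm.pow_const _)] at h
    simp only [Pi.mul_apply, mul_one] at h
    calc (∫⁻ t, f t * g (t - x)) ^ 2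
        ≤ ((∫⁻ t, f t) ^ (1 / 2 : ℝ) * (∫⁻ t, f t * g (t - x) ^ (2 : ℝ)) ^ (1 / 2 : ℝ)) ^ 2 := by
          gcongr
      _ = _ := by
          rw [mul_pow, ← ENNReal.rpow_natCast, ← ENNReal.rpow_natCast, ← ENNReal.rpow_mul,
            ← ENNReal.rpow_mul]
          norm_num
  calc ∫⁻ x, (∫⁻ t, f t * g (t - x)) ^ 2
      ≤ ∫⁻ x, (∫⁻ t, f t) * ∫⁻ t, f t * g (t - x) ^ 2 := lintegral_mono cs
    _ = (∫⁻ t, f t) * ∫⁻ x, ∫⁻ t, f t * g (t - x) ^ 2 :=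
        lintegral_const_mul _ (Measurable.lintegral_prod_right' (f := fun p : ℝ × ℝ =>
          f p.2 * g (p.2 - p.1) ^ 2) (by fun_prop))
    _ = (∫⁻ t, f t) * ∫⁻ t, ∫⁻ x, f t * g (t - x) ^ 2 := by
        rw [lintegral_lintegral_swap]
        exact Measurable.aemeasurable (by fun_prop)
    _ = (∫⁻ t, f t) * ∫⁻ t, f t * ∫⁻ s, g s ^ 2 := by
        congr 2; ext t
        rw [lintegral_const_mul _ (by fun_prop), lintegral_sub_left_eq_self (fun s => g s ^ 2) t]
    _ = _ := by rw [lintegral_mul_const _ hf, ← mul_assoc, sq]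

/-- The correlation `x ↦ ∫ f(t) g(t - x) dt` of an integrable and a square integrable function is
square integrable. -/
theorem memLp_two_correlation {f g : ℝ → ℝ} (hf : Integrable f) (hg : MemLp g 2) :
    MemLp (fun x => ∫ t, f t * g (t - x)) 2 := by
  have hmeas : AEStronglyMeasurable (fun p : ℝ × ℝ => f p.2 * g (p.2 - p.1))
      (volume.prod volume) := by
    refine hf.1.comp_snd.mul (hg.1.comp_quasiMeasurePreserving ?_)
    exact (quasiMeasurePreserving_sub_of_right_invariant volume volume).comp
      Measure.measurePreserving_swap.quasiMeasurePreserving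
  refine ⟨hmeas.integral_prod_right', ?_⟩
  rw [eLpNorm_lt_top_iff_lintegral_rpow_enorm_lt_top (by norm_num) (by norm_num)]
  obtain ⟨f', hf'm, hff'⟩ := hf.1.enorm
  obtain ⟨g', hg'm, hgg'⟩ := hg.1.enorm
  have hf2 : ∫⁻ t, f' t < ⊤ := by
    rw [← lintegral_congr_ae hff']; exact hf.2
  have hg2 : ∫⁻ t, g' t ^ 2 < ⊤ := by
    have := hg.2
    rw [eLpNorm_lt_top_iff_lintegral_rpow_enorm_lt_top (by norm_num) (by norm_num)] at this
    refine lt_of_le_of_lt (le_of_eq (lintegral_congr_ae ?_)) this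
    filter_upwards [hgg'] with t ht
    simp [ht]
  refine lt_of_le_of_lt ?_ (lt_of_le_of_lt (lintegral_sq_lintegral_mul_le hf'm hg'm)
    (ENNReal.mul_lt_top (ENNReal.pow_lt_top hf2) hg2))
  refine lintegral_mono fun x => ?_
  simp only [ENNReal.toReal_ofNat, ENNReal.rpow_ofNat]
  gcongr
  refine (enorm_integral_le_lintegral_enorm _).trans (le_of_eq (lintegral_congr_ae ?_))
  have hshift := (measurePreserving_sub_right volume x).quasiMeasurePreserving.ae_eq_comp hgg'
  filter_upwards [hff', hshift] with t h1 h2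
  simp only [Function.comp] at h2
  rw [enorm_mul, h1, h2]

/-! ### Bernstein functions on the half-plane -/

theorem norm_one_sub_cexp_neg_mul_le {s : ℝ} {z : ℂ} (hs : 0 < s) (hz : 0 ≤ z.re) :
    ‖1 - Complex.exp (-(s * z))‖ ≤ 2 * (1 + ‖z‖) * min s 1 := by
  have h0 : ‖Complex.exp (-(s * z))‖ ≤ 1 := by
    rw [Complex.norm_exp, Real.exp_le_one_iff]
    simpa using mul_nonneg hs.le hz
  have h1 : ‖1 - Complex.exp (-(s * z))‖ ≤ 2 :=
    (norm_sub_le _ _).trans (by rw [norm_one]; linarith)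
  have hn : ‖-((s : ℂ) * z)‖ = s * ‖z‖ := by
    rw [norm_neg, norm_mul, Complex.norm_real, Real.norm_of_nonneg hs.le]
  have h2 : ‖1 - Complex.exp (-(s * z))‖ ≤ 2 * (s * ‖z‖) := by
    rcases le_total (s * ‖z‖) 1 with h | h
    · rw [norm_sub_rev, ← hn]
      exact Complex.norm_exp_sub_one_le (hn.le.trans h)
    · linarith
  have hz0 := norm_nonneg z
  rcases le_total s 1 with h | h
  · rw [min_eq_left h]; nlinarith
  · rw [min_eq_right h]; nlinarith

theorem mul_exp_neg_mul_le {s r : ℝ} (hr : 0 < r) :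
    s * Real.exp (-(s * r)) ≤ r⁻¹ := by
  have h := Real.add_one_le_exp (s * r)
  rw [Real.exp_neg, ← div_eq_mul_inv, div_le_iff₀ (Real.exp_pos _), inv_mul_eq_div, le_div_iff₀ hr]
  linarith

/-- Differentiation under the integral; near `z₀` the derivative is dominated because `Re z > Re z₀
/ 2`. The case `c = 1` serves `φ`, and `c = 0` the Laplace transform of `κ` up to sign. -/
theorem differentiableOn_integral_sub_cexp {w : ℝ → ℝ} (c : ℂ)
    (hw : AEStronglyMeasurable w (volume.restrict (Ioi 0)))
    (hI : ∀ z : ℂ, 0 < z.re →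
      IntegrableOn (fun s : ℝ => (c - Complex.exp (-(s * z))) * (w s : ℂ)) (Ioi 0))
    (hI' : ∀ r : ℝ, 0 < r → IntegrableOn (fun s => s * Real.exp (-(s * r)) * w s) (Ioi 0)) :
    DifferentiableOn ℂ
      (fun z => ∫ s in Ioi (0 : ℝ), (c - Complex.exp (-(s * z))) * (w s : ℂ))
      {z | 0 < z.re} := by
  intro z₀ hz₀
  replace hz₀ : 0 < z₀.re := hz₀
  have hwc : AEStronglyMeasurable (fun s => (w s : ℂ)) (volume.restrict (Ioi 0)) :=
    Complex.continuous_ofReal.comp_aestronglyMeasurable hw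
  have hU : {z : ℂ | z₀.re / 2 < z.re} ∈ 𝓝 z₀ :=
    (isOpen_lt continuous_const Complex.continuous_re).mem_nhds (by simp; linarith)
  have key := hasDerivAt_integral_of_dominated_loc_of_deriv_le
    (μ := volume.restrict (Ioi (0 : ℝ)))
    (F := fun z (s : ℝ) => (c - Complex.exp (-(s * z))) * (w s : ℂ))
    (F' := fun z (s : ℝ) => (s * Complex.exp (-(s * z))) * (w s : ℂ))
    (bound := fun s => ‖s * Real.exp (-(s * (z₀.re / 2))) * w s‖) hU
    (Eventually.of_forall fun z => (Continuous.aestronglyMeasurable (by fun_prop)).mul hwc)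
    (hI z₀ hz₀)
    ((Continuous.aestronglyMeasurable (by fun_prop)).mul hwc) ?_
    (hI' _ (by linarith)).norm ?_
  · exact key.2.differentiableAt.differentiableWithinAt
  · filter_upwards [ae_restrict_mem measurableSet_Ioi] with s hs z hz
    simp only [norm_mul, Complex.norm_real, Complex.norm_exp]
    have hs' : 0 < s := hs
    replace hz : z₀.re / 2 < z.re := hz
    rw [Real.norm_of_nonneg (Real.exp_pos _).le]
    gcongr
    simpa using mul_le_mul_of_nonneg_left hz.le hs'.le
  · refine ae_of_all _ fun s z _ => ?_
    have h1 : HasDerivAt (fun z : ℂ => -((s : ℂ) * z)) (-(s : ℂ)) z := by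
      have h := ((hasDerivAt_id z).const_mul (s : ℂ)).neg
      rw [mul_one] at h
      exact h
    have h2 := (h1.cexp.const_sub c).mul_const (w s : ℂ)
    refine h2.congr_deriv ?_
    ring

namespace IsCompleteBernstein

variable {φ nuBar κ : ℝ → ℝ} (hφ : IsCompleteBernstein φ nuBar)
include hφ

theorem nonneg {s : ℝ} (hs : 0 < s) : 0 ≤ nuBar s := by
  simpa using hφ.completelyMonotone.2 0 s hs

theorem aestronglyMeasurable : AEStronglyMeasurable nuBar (volume.restrict (Ioi 0)) :=
  hφ.completelyMonotone.1.continuousOn.aestronglyMeasurable measurableSet_Ioi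

theorem norm_integrand_le {s : ℝ} {z : ℂ} (hs : 0 < s) (hz : 0 ≤ z.re) :
    ‖(1 - Complex.exp (-(s * z))) * (nuBar s : ℂ)‖ ≤
      2 * (1 + ‖z‖) * (min s 1 * nuBar s) := by
  rw [norm_mul, Complex.norm_real, Real.norm_of_nonneg (hφ.nonneg hs), ← mul_assoc]
  exact mul_le_mul_of_nonneg_right (norm_one_sub_cexp_neg_mul_le hs hz) (hφ.nonneg hs)

theorem aestronglyMeasurable_integrand (z : ℂ) :
    AEStronglyMeasurable (fun s : ℝ => (1 - Complex.exp (-(s * z))) * (nuBar s : ℂ))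
      (volume.restrict (Ioi 0)) :=
  (Continuous.aestronglyMeasurable (by fun_prop)).mul
    (Complex.continuous_ofReal.comp_aestronglyMeasurable hφ.aestronglyMeasurable)

theorem integrableOn_integrand {z : ℂ} (hz : 0 ≤ z.re) :
    IntegrableOn (fun s : ℝ => (1 - Complex.exp (-(s * z))) * (nuBar s : ℂ)) (Ioi 0) := by
  refine Integrable.mono' (hφ.levy.const_mul (2 * (1 + ‖z‖)))
    (hφ.aestronglyMeasurable_integrand z) ?_
  filter_upwards [ae_restrict_mem measurableSet_Ioi] with s hs
  exact hφ.norm_integrand_le hs hz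

theorem differentiableOn_bernsteinExt : DifferentiableOn ℂ (bernsteinExt nuBar) {z | 0 < z.re} := by
  refine differentiableOn_integral_sub_cexp 1 hφ.aestronglyMeasurable
    (fun z hz => hφ.integrableOn_integrand hz.le) fun r hr => ?_
  refine Integrable.mono' (hφ.levy.const_mul (1 + r⁻¹))
    ((Continuous.aestronglyMeasurable (by fun_prop)).mul hφ.aestronglyMeasurable) ?_
  filter_upwards [ae_restrict_mem measurableSet_Ioi] with s hs
  have hs' : 0 < s := hs
  have hr' : 0 < r⁻¹ := inv_pos.2 hr
  rw [norm_mul, Real.norm_of_nonneg (hφ.nonneg hs), Real.norm_of_nonneg (by positivity),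
    ← mul_assoc]
  refine mul_le_mul_of_nonneg_right ?_ (hφ.nonneg hs)
  -- Both bounds `s` and `r⁻¹` are needed, to reach `(1 + r⁻¹) * min s 1`.
  have h1 := mul_exp_neg_mul_le (s := s) hr
  have h2 : s * Real.exp (-(s * r)) ≤ s :=
    mul_le_of_le_one_right hs'.le (Real.exp_le_one_iff.2 (by nlinarith))
  rcases le_total s 1 with h | h
  · rw [min_eq_left h]; nlinarith
  · rw [min_eq_right h]; linarith

theorem bernsteinExt_ofReal {x : ℝ} (hx : 0 < x) : bernsteinExt nuBar x = φ x := by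
  rw [hφ.repr x hx, bernsteinExt, ← integral_complex_ofReal]
  congr 1; ext s
  push_cast
  rfl

theorem tendsto_bernsteinExt {θ : ℕ → ℝ} (hθ : ∀ n, 0 ≤ θ n) (hlim : Tendsto θ atTop (𝓝 0))
    (ξ : ℝ) : Tendsto (fun n => bernsteinExt nuBar (θ n + Complex.I * ξ)) atTop
      (𝓝 (bernsteinExt nuBar (Complex.I * ξ))) := by
  obtain ⟨M, hM⟩ := hlim.bddAbove_range
  have hlimC : Tendsto (fun n => (θ n : ℂ) + Complex.I * ξ) atTop (𝓝 (Complex.I * ξ)) := by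
    have := ((Complex.continuous_ofReal.tendsto 0).comp hlim).add_const (Complex.I * (ξ : ℂ))
    simpa using this
  refine tendsto_integral_of_dominated_convergence
    (fun s => 2 * (1 + (M + |ξ|)) * (min s 1 * nuBar s))
    (fun n => hφ.aestronglyMeasurable_integrand _) (hφ.levy.const_mul _) (fun n => ?_) ?_
  · filter_upwards [ae_restrict_mem measurableSet_Ioi] with s hs
    have hs' : 0 < s := hs
    refine (hφ.norm_integrand_le hs (by simpa using hθ n)).trans ?_
    have hν := hφ.nonneg hs
    gcongr
    refine (norm_add_le _ _).trans ?_
    simp only [norm_mul, Complex.norm_I, Complex.norm_real, one_mul, Real.norm_eq_abs,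
      abs_of_nonneg (hθ n)]
    gcongr
    exact hM ⟨n, rfl⟩
  · refine ae_of_all _ fun s => ?_
    exact ((hlimC.const_mul (s : ℂ)).neg.cexp.const_sub 1).mul_const _

/-- The real part is the integral of `(1 - cos(sξ)) * nuBar s ≥ 0`. If it vanishes, then `nuBar = 0`
a.e., because `cos(sξ) = 1` only on a countable set; this forces `φ x = 0`. -/
theorem bernsteinExt_I_mul_ne_zero {x : ℝ} (hx : 0 < x) (hφx : φ x ≠ 0) {ξ : ℝ} (hξ : ξ ≠ 0) :
    bernsteinExt nuBar (Complex.I * ξ) ≠ 0 := by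
  intro h0
  have hre : ∀ s : ℝ, ((1 - Complex.exp (-(s * (Complex.I * ξ)))) * (nuBar s : ℂ)).re =
      (1 - Real.cos (s * ξ)) * nuBar s := by
    intro s
    have : -((s : ℂ) * (Complex.I * ξ)) = ((-(s * ξ) : ℝ) : ℂ) * Complex.I := by push_cast; ring
    rw [this, Complex.re_mul_ofReal, Complex.sub_re, Complex.exp_ofReal_mul_I_re, Real.cos_neg,
      Complex.one_re]
  have hint := hφ.integrableOn_integrand (z := Complex.I * ξ) (by simp)
  have h1 : ∫ s in Ioi (0 : ℝ), (1 - Real.cos (s * ξ)) * nuBar s = 0 := by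
    rw [← integral_congr_ae (ae_of_all _ hre)]
    have := integral_re (𝕜 := ℂ) hint
    simp only [RCLike.re_to_complex] at this
    rw [this]
    exact (congrArg Complex.re h0)
  have hint' : Integrable (fun s => (1 - Real.cos (s * ξ)) * nuBar s)
      (volume.restrict (Ioi 0)) := by
    simpa only [RCLike.re_to_complex, hre] using hint.re
  rw [integral_eq_zero_iff_of_nonneg_ae _ hint'] at h1
  · have hcount : {s : ℝ | Real.cos (s * ξ) = 1}.Countable := by
      refine (countable_range fun n : ℤ => (n * (2 * Real.pi)) / ξ).mono fun s hs => ?_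
      obtain ⟨n, hn⟩ := (Real.cos_eq_one_iff _).1 hs
      exact ⟨n, by simp only [hn]; field_simp⟩
    have hne : ∀ᵐ s ∂(volume.restrict (Ioi (0 : ℝ))), Real.cos (s * ξ) ≠ 1 :=
      ae_restrict_of_ae (hcount.ae_notMem volume)
    apply hφx
    rw [hφ.repr x hx]
    refine integral_eq_zero_of_ae ?_
    filter_upwards [h1, hne] with s hs1 hs2
    have : nuBar s = 0 := by
      rcases mul_eq_zero.1 hs1 with h | h
      · exact absurd (by linarith) hs2
      · exact h
    simp [this]
  · filter_upwards [ae_restrict_mem measurableSet_Ioi] with s hs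
    exact mul_nonneg (by linarith [Real.cos_le_one (s * ξ)]) (hφ.nonneg hs)

end IsCompleteBernstein

/-! ### Laplace transform of the Sonine kernel -/

namespace IsSonineKernel

variable {φ nuBar κ : ℝ → ℝ} (hκ : IsSonineKernel φ κ)
include hκ

theorem aestronglyMeasurable : AEStronglyMeasurable κ (volume.restrict (Ioi 0)) := by
  have h := (hκ.integrable 1 one_pos).1
  have h2 : AEStronglyMeasurable (fun s : ℝ => Real.exp s) (volume.restrict (Ioi 0)) :=
    Real.continuous_exp.aestronglyMeasurable
  refine (h2.mul h).congr (ae_of_all _ fun s => ?_)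
  simp [← mul_assoc, ← Real.exp_add]

theorem integrableOn_cexp_mul {z : ℂ} (hz : 0 < z.re) :
    IntegrableOn (fun s : ℝ => Complex.exp (-(s * z)) * (κ s : ℂ)) (Ioi 0) := by
  refine Integrable.mono' (hκ.integrable _ hz) ((Continuous.aestronglyMeasurable (by fun_prop)).mul
    (Complex.continuous_ofReal.comp_aestronglyMeasurable hκ.aestronglyMeasurable)) ?_
  filter_upwards [ae_restrict_mem measurableSet_Ioi] with s hs
  rw [norm_mul, Complex.norm_real, Real.norm_of_nonneg (hκ.nonneg s hs), Complex.norm_exp]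
  simp

theorem differentiableOn_laplace :
    DifferentiableOn ℂ (fun z => ∫ s in Ioi (0 : ℝ), Complex.exp (-(s * z)) * (κ s : ℂ))
      {z | 0 < z.re} := by
  have h := differentiableOn_integral_sub_cexp 0 hκ.aestronglyMeasurable
    (fun z hz => by simpa using (hκ.integrableOn_cexp_mul hz).neg) fun r hr => ?_
  · refine h.neg.congr fun z _ => ?_
    simp [← integral_neg]
  -- Half of the decay absorbs the factor `s`; the other half keeps `κ` integrable.
  · have hr2 : 0 < r / 2 := half_pos hr
    refine Integrable.mono' ((hκ.integrable (r / 2) hr2).const_mul (r / 2)⁻¹)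
      ((Continuous.aestronglyMeasurable (by fun_prop)).mul hκ.aestronglyMeasurable) ?_
    filter_upwards [ae_restrict_mem measurableSet_Ioi] with s hs
    have hs' : 0 < s := hs
    rw [norm_mul, Real.norm_of_nonneg (hκ.nonneg s hs), Real.norm_of_nonneg (by positivity),
      ← mul_assoc]
    refine mul_le_mul_of_nonneg_right ?_ (hκ.nonneg s hs)
    have h1 := mul_exp_neg_mul_le (s := s) hr2
    have h2 : Real.exp (-(s * r)) = Real.exp (-(s * (r / 2))) * Real.exp (-(s * (r / 2))) := by
      rw [← Real.exp_add]; congr 1; ring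
    rw [h2, ← mul_assoc]
    gcongr

/-- The Laplace transform identity extends to the open right half-plane. -/
theorem laplace_mul_bernsteinExt (hφ : IsCompleteBernstein φ nuBar) {z : ℂ} (hz : 0 < z.re) :
    (∫ s in Ioi (0 : ℝ), Complex.exp (-(s * z)) * (κ s : ℂ)) * bernsteinExt nuBar z = 1 := by
  have hopen : IsOpen {z : ℂ | 0 < z.re} := isOpen_lt continuous_const Complex.continuous_re
  have hconn : IsPreconnected {z : ℂ | 0 < z.re} := (convex_halfSpace_re_gt 0).isPreconnected
  have hf := (hκ.differentiableOn_laplace.mul hφ.differentiableOn_bernsteinExt).analyticOnNhd hopen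
  have hreal : ∀ x : ℝ, 0 < x → (∫ s in Ioi (0 : ℝ), Complex.exp (-(s * (x : ℂ))) * (κ s : ℂ)) *
      bernsteinExt nuBar x = 1 := by
    intro x hx
    rw [hφ.bernsteinExt_ofReal hx, ← Complex.ofReal_one, ← hκ.laplace x hx, Complex.ofReal_mul,
      ← integral_complex_ofReal]
    congr 2; ext s
    push_cast
    rfl
  refine hf.eqOn_of_preconnected_of_frequently_eq (analyticOnNhd_const (v := (1 : ℂ))) hconn
    (z₀ := 1) (by simp) ?_ hz
  -- Real points accumulating at `1` feed the identity theorem.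
  have hseq : Tendsto (fun n : ℕ => ((1 + 1 / ((n : ℝ) + 1) : ℝ) : ℂ)) atTop (𝓝[≠] 1) := by
    refine tendsto_nhdsWithin_iff.2 ⟨?_, Eventually.of_forall fun n => ?_⟩
    · have h1 : Tendsto (fun n : ℕ => 1 + 1 / ((n : ℝ) + 1)) atTop (𝓝 (1 + 0)) :=
        tendsto_one_div_add_atTop_nhds_zero_nat.const_add 1
      have h2 := (Complex.continuous_ofReal.tendsto _).comp h1
      simpa [Function.comp_def] using h2
    · have : (0 : ℝ) < 1 / ((n : ℝ) + 1) := by positivity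
      simp only [mem_compl_iff, mem_singleton_iff]
      intro h
      have h' : 1 + 1 / ((n : ℝ) + 1) = 1 := by exact_mod_cast h
      linarith
  refine hseq.frequently (Frequently.of_forall fun n => ?_)
  exact hreal _ (by positivity)

end IsSonineKernel

/-! ### The fractional integral of an indicator -/

theorem charFourier_convolution {f g : ℝ → ℂ} (hf : Integrable f) (hg : Integrable g) (ξ : ℝ) :
    charFourier (f ⋆[ContinuousLinearMap.mul ℂ ℂ] g) ξ = charFourier f ξ * charFourier g ξ := by
  simp only [charFourier_eq_fourier]
  exact Real.fourier_mul_convolution_eq hf hg _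

theorem charFourier_indicator_Ioo {a b : ℝ} (hab : a ≤ b) {ξ : ℝ} (hξ : ξ ≠ 0) :
    charFourier (fun t => (((Ioo a b).indicator (fun _ => (1 : ℝ)) t : ℝ) : ℂ)) ξ =
      (Complex.exp (Complex.I * b * ξ) - Complex.exp (Complex.I * a * ξ)) / (Complex.I * ξ) := by
  have h1 : ∀ x : ℝ, Complex.exp (Complex.I * ξ * x) *
      (((Ioo a b).indicator (fun _ => (1 : ℝ)) x : ℝ) : ℂ) =
      (Ioo a b).indicator (fun x : ℝ => Complex.exp (Complex.I * ξ * x)) x := by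
    intro x
    by_cases hx : x ∈ Ioo a b <;> simp [hx]
  simp only [charFourier, h1]
  rw [integral_indicator measurableSet_Ioo, ← integral_Ioc_eq_integral_Ioo,
    ← intervalIntegral.integral_of_le hab, integral_exp_mul_complex (by simpa using hξ)]
  simp only [mul_right_comm]

/-- The kernel `κ` extended by zero to the negative half-line. -/
noncomputable def zeroExtend (κ : ℝ → ℝ) : ℝ → ℝ := (Ioi 0).indicator κ

theorem zeroExtend_nonneg {φ κ : ℝ → ℝ} (hκ : IsSonineKernel φ κ) (s : ℝ) :
    0 ≤ zeroExtend κ s :=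
  indicator_nonneg (fun _ hs => hκ.nonneg _ hs) s

theorem indicator_Ioi_shift (κ f : ℝ → ℝ) (x : ℝ) :
    (Ioi x).indicator (fun t => f t * κ (t - x)) = fun t => f t * zeroExtend κ (t - x) := by
  ext t
  by_cases ht : x < t <;> simp [zeroExtend, ht]

theorem fracIntegral_eq_integral (κ f : ℝ → ℝ) (x : ℝ) :
    fracIntegral κ f x = ∫ t, f t * zeroExtend κ (t - x) := by
  rw [fracIntegral, ← integral_indicator measurableSet_Ioi, indicator_Ioi_shift]

theorem intervalIntegrable_zeroExtend {κ : ℝ → ℝ}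
    (h : ∀ ε : ℝ, 0 < ε → IntegrableOn κ (Ioo 0 ε)) (c d : ℝ) :
    IntervalIntegrable (zeroExtend κ) volume c d := by
  have hpos : 0 < max (max c d) 0 + 1 := by positivity
  have h1 : IntegrableOn (zeroExtend κ) (Iio (max (max c d) 0 + 1)) := by
    rw [zeroExtend, integrableOn_indicator_iff measurableSet_Ioi, Ioi_inter_Iio]
    exact h _ hpos
  rw [intervalIntegrable_iff]
  refine h1.mono_set fun t ht => ?_
  have : t ≤ max c d := ht.2
  exact lt_of_le_of_lt (this.trans (le_max_left _ 0)) (lt_add_one _)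

/-- The source of the positive parts in the formula for the fractional integral. -/
theorem integral_zeroExtend (κ : ℝ → ℝ) (y : ℝ) :
    ∫ s in (0 : ℝ)..y, zeroExtend κ s = kernelPrimitive κ (max y 0) := by
  rcases le_total y 0 with hy | hy
  · rw [max_eq_right hy, kernelPrimitive, intervalIntegral.integral_same,
      intervalIntegral.integral_of_ge hy, neg_eq_zero]
    refine setIntegral_eq_zero_of_forall_eq_zero fun s hs => ?_
    exact indicator_of_notMem (by simpa using hs.2) _
  · rw [max_eq_left hy, kernelPrimitive, intervalIntegral.integral_of_le hy,
      intervalIntegral.integral_of_le hy]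
    exact setIntegral_congr_fun measurableSet_Ioc fun s hs => indicator_of_mem hs.1 _

section

variable {φ nuBar κ : ℝ → ℝ} {a b : ℝ}

theorem indicator_one_mul (s : Set ℝ) (g : ℝ → ℝ) :
    (fun t => s.indicator (fun _ => (1 : ℝ)) t * g t) = s.indicator g := by
  ext t
  by_cases ht : t ∈ s <;> simp [ht]

theorem integrable_indicator_mul_zeroExtend
    (h : ∀ ε : ℝ, 0 < ε → IntegrableOn κ (Ioo 0 ε)) (hab : a ≤ b) (x : ℝ) :
    Integrable (fun t => (Ioo a b).indicator (fun _ => (1 : ℝ)) t * zeroExtend κ (t - x)) := by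
  rw [indicator_one_mul (Ioo a b) fun t => zeroExtend κ (t - x),
    integrable_indicator_iff measurableSet_Ioo]
  have h1 := (intervalIntegrable_zeroExtend h (a - x) (b - x)).comp_sub_right x
  simp only [sub_add_cancel] at h1
  exact ((intervalIntegrable_iff_integrableOn_Ioc_of_le hab).1 h1).mono_set Ioo_subset_Ioc_self

theorem fracIntegral_indicator_Ioo
    (h : ∀ ε : ℝ, 0 < ε → IntegrableOn κ (Ioo 0 ε)) (hab : a ≤ b) (x : ℝ) :
    fracIntegral κ ((Ioo a b).indicator (fun _ => (1 : ℝ))) x =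
      kernelPrimitive κ (max (b - x) 0) - kernelPrimitive κ (max (a - x) 0) := by
  have hi := intervalIntegrable_zeroExtend h
  rw [fracIntegral_eq_integral, indicator_one_mul (Ioo a b) fun t => zeroExtend κ (t - x),
    integral_indicator measurableSet_Ioo, ← integral_Ioc_eq_integral_Ioo,
    ← intervalIntegral.integral_of_le hab, intervalIntegral.integral_comp_sub_right,
    ← intervalIntegral.integral_interval_sub_left (hi 0 _) (hi 0 _), integral_zeroExtend,
    integral_zeroExtend]

theorem memLp_indicator_Ioo_one (a b : ℝ) (p : ENNReal) :
    MemLp ((Ioo a b).indicator (fun _ => (1 : ℝ))) p :=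
  memLp_indicator_const p measurableSet_Ioo 1 (Or.inr (by simp))

theorem memLp_two_fracIntegral (h1 : ∀ ε : ℝ, 0 < ε → IntegrableOn κ (Ioo 0 ε))
    (h2 : MemLp κ 2 (volume.restrict (Ioi 1))) (hab : a ≤ b) :
    MemLp (fracIntegral κ ((Ioo a b).indicator (fun _ => (1 : ℝ)))) 2 := by
  set I : ℝ → ℝ := (Ioo a b).indicator (fun _ => (1 : ℝ)) with hI
  set k0 : ℝ → ℝ := (Ioc 0 1).indicator κ
  set k1 : ℝ → ℝ := (Ioi 1).indicator κ
  have hk0 : Integrable k0 := by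
    rw [integrable_indicator_iff measurableSet_Ioc]
    exact (h1 2 two_pos).mono_set fun s hs => ⟨hs.1, hs.2.trans_lt one_lt_two⟩
  have hk1 : MemLp k1 2 := (memLp_indicator_iff_restrict measurableSet_Ioi).2 h2
  have hk : ∀ s, zeroExtend κ s = k0 s + k1 s := by
    intro s
    simp only [zeroExtend, k0, k1, indicator_apply, mem_Ioi, mem_Ioc]
    rcases le_or_gt s 0 with hs | hs
    · simp [hs.not_gt, (hs.trans zero_le_one).not_gt]
    · rcases le_or_gt s 1 with hs' | hs'
      · simp [hs, hs', hs'.not_gt]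
      · simp [hs, hs', hs'.not_ge]
  have hu1 : MemLp (fun x => ∫ t, I t * k1 (t - x)) 2 :=
    memLp_two_correlation (memLp_one_iff_integrable.1 (memLp_indicator_Ioo_one a b 1)) hk1
  -- Here the kernel is the `L¹` factor, so the roles are swapped; a reflection in `x` and a
  -- translation in `t` restore the original form.
  have hu0 : MemLp (fun x => ∫ t, I t * k0 (t - x)) 2 := by
    have h := (memLp_two_correlation hk0 (memLp_indicator_Ioo_one a b 2)).comp_measurePreserving
      (Measure.measurePreserving_neg (volume : Measure ℝ))
    refine h.ae_eq (ae_of_all _ fun x => ?_)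
    simp only [Function.comp, sub_neg_eq_add]
    rw [← integral_add_right_eq_self (fun t => I t * k0 (t - x)) x]
    refine integral_congr_ae (ae_of_all _ fun t => ?_)
    simp [I, mul_comm]
  have hi0 : ∀ x, Integrable (fun t => I t * k0 (t - x)) := fun x => by
    have := (hk0.comp_sub_right x).indicator (measurableSet_Ioo (a := a) (b := b))
    rwa [← indicator_one_mul] at this
  refine (hu0.add hu1).ae_eq (ae_of_all _ fun x => ?_)
  have hi1 : Integrable (fun t => I t * k1 (t - x)) := by
    refine ((integrable_indicator_mul_zeroExtend h1 hab x).sub (hi0 x)).congr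
      (ae_of_all _ fun t => ?_)
    simp only [Pi.sub_apply, hk, hI]
    ring
  simp only [Pi.add_apply]
  rw [fracIntegral_eq_integral, ← integral_add (hi0 x) hi1]
  refine integral_congr_ae (ae_of_all _ fun t => ?_)
  simp only [hk, mul_add]

/-! ### Damping and the Fourier formula -/

/-- The exponentially damped kernel, as a complex function on the line. -/
noncomputable def dampedKernel (κ : ℝ → ℝ) (θ s : ℝ) : ℂ := ((Real.exp (-(s * θ)) * zeroExtend κ s : ℝ) : ℂ)

theorem integrable_dampedKernel (hκ : IsSonineKernel φ κ) {θ : ℝ} (hθ : 0 < θ) :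
    Integrable (dampedKernel κ θ) := by
  suffices h : Integrable (fun s => Real.exp (-(s * θ)) * zeroExtend κ s) from h.ofReal
  have h := (integrable_indicator_iff measurableSet_Ioi).2 (hκ.integrable θ hθ)
  refine h.congr (ae_of_all _ fun s => ?_)
  by_cases hs : 0 < s <;> simp [zeroExtend, hs]

/-- Reflecting the kernel turns the correlation into a convolution and places the Laplace variable
at `θ + iξ`. -/
theorem charFourier_dampedKernel_neg (θ ξ : ℝ) :
    charFourier (fun y => dampedKernel κ θ (-y)) ξ =
      ∫ s in Ioi (0 : ℝ), Complex.exp (-(s * (θ + Complex.I * ξ))) * (κ s : ℂ) := by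
  rw [charFourier, ← integral_neg_eq_self, ← integral_indicator measurableSet_Ioi]
  congr 1; ext s
  by_cases hs : 0 < s
  · simp only [dampedKernel, zeroExtend, neg_neg, indicator_of_mem (mem_Ioi.2 hs)]
    push_cast
    rw [← mul_assoc, ← Complex.exp_add]
    congr 2; ring
  · simp [dampedKernel, zeroExtend, hs]

theorem convolution_dampedKernel_apply (f : ℝ → ℂ) (θ x : ℝ) :
    (f ⋆[ContinuousLinearMap.mul ℂ ℂ] fun y => dampedKernel κ θ (-y)) x =
      ∫ t, f t * dampedKernel κ θ (t - x) := by
  simp [convolution]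

theorem norm_dampedKernel_le (hκ : IsSonineKernel φ κ) {θ : ℝ} (hθ : 0 ≤ θ) (s : ℝ) :
    ‖dampedKernel κ θ s‖ ≤ zeroExtend κ s := by
  have h0 := zeroExtend_nonneg hκ s
  rw [dampedKernel, Complex.norm_real, norm_mul, Real.norm_of_nonneg (Real.exp_pos _).le,
    Real.norm_of_nonneg h0]
  by_cases hs : 0 < s
  · exact mul_le_of_le_one_left h0 (Real.exp_le_one_iff.2 (by nlinarith))
  · simp [zeroExtend, hs]

theorem isDistribFourier_fracIntegral (hφ : IsCompleteBernstein φ nuBar)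
    (hκ : IsSonineKernel φ κ) (h1 : ∀ ε : ℝ, 0 < ε → IntegrableOn κ (Ioo 0 ε))
    (h2 : MemLp κ 2 (volume.restrict (Ioi 1))) (hab : a ≤ b) :
    IsDistribFourier
      (fun x => (fracIntegral κ ((Ioo a b).indicator (fun _ => (1 : ℝ))) x : ℂ))
      (fun ξ => (bernsteinExt nuBar (Complex.I * ξ))⁻¹ *
        ((Complex.exp (Complex.I * b * ξ) - Complex.exp (Complex.I * a * ξ)) /
          (Complex.I * ξ))) := by
  set I : ℝ → ℝ := (Ioo a b).indicator (fun _ => (1 : ℝ)) with hI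
  have hI0 : ∀ t, 0 ≤ I t := fun t => indicator_nonneg (fun _ _ => zero_le_one) t
  let θ : ℕ → ℝ := fun n => 1 / ((n : ℝ) + 1)
  have hθ : ∀ n, 0 < θ n := fun n => by positivity
  have hθlim : Tendsto θ atTop (𝓝 0) := tendsto_one_div_add_atTop_nhds_zero_nat
  let F : ℕ → ℝ → ℂ := fun n =>
    (fun t => (I t : ℂ)) ⋆[ContinuousLinearMap.mul ℂ ℂ] fun y => dampedKernel κ (θ n) (-y)
  have hIint : Integrable (fun t => (I t : ℂ)) :=
    (memLp_one_iff_integrable.1 (memLp_indicator_Ioo_one a b 1)).ofReal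
  have hkint : ∀ n, Integrable (fun y => dampedKernel κ (θ n) (-y)) := fun n =>
    (integrable_dampedKernel hκ (hθ n)).comp_neg
  have hF : ∀ n x, F n x = ∫ t, (I t : ℂ) * dampedKernel κ (θ n) (t - x) := fun n x =>
    convolution_dampedKernel_apply _ _ _
  have hF1 : ∀ n, Integrable (F n) := fun n => hIint.integrable_convolution _ (hkint n)
  have hu : MemLp (fun x => (fracIntegral κ I x : ℂ)) 2 :=
    (memLp_two_fracIntegral h1 h2 hab).ofReal
  have hint := integrable_indicator_mul_zeroExtend h1 hab
  have hptw : ∀ n x t, ‖(I t : ℂ) * dampedKernel κ (θ n) (t - x)‖ ≤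
      I t * zeroExtend κ (t - x) := by
    intro n x t
    rw [norm_mul, Complex.norm_real, Real.norm_of_nonneg (hI0 t)]
    exact mul_le_mul_of_nonneg_left (norm_dampedKernel_le hκ (hθ n).le _) (hI0 t)
  have hle : ∀ n x, ‖F n x‖ ≤ ‖(fracIntegral κ I x : ℂ)‖ := by
    intro n x
    rw [hF, Complex.norm_real]
    refine (norm_integral_le_of_norm_le (hint x) (ae_of_all _ (hptw n x))).trans ?_
    rw [← fracIntegral_eq_integral]
    exact le_abs_self _
  have hlim : ∀ x, Tendsto (fun n => F n x) atTop (𝓝 (fracIntegral κ I x : ℂ)) := by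
    intro x
    simp only [hF, fracIntegral_eq_integral, ← integral_complex_ofReal]
    refine tendsto_integral_of_dominated_convergence _ (fun n => ?_) (hint x)
      (fun n => ae_of_all _ (hptw n x)) (ae_of_all _ fun t => ?_)
    · exact hIint.1.mul ((integrable_dampedKernel hκ (hθ n)).comp_sub_right x).1
    · have h := ((((hθlim.const_mul (t - x)).neg.rexp).mul_const
        (zeroExtend κ (t - x))).const_mul (I t)).ofReal
      simpa [dampedKernel] using h
  have hF2 : ∀ n, MemLp (F n) 2 := fun n => hu.mono (hF1 n).1 (ae_of_all _ (hle n))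
  refine isDistribFourier_of_tendsto hF1 hF2 hu
    (tendsto_eLpNorm_two_of_dominated (fun n => (hF1 n).1) hu (fun n => ae_of_all _ (hle n))
      (ae_of_all _ hlim)) ?_
  -- At `ξ = 0` both `φ(iξ)` and the denominator `iξ` vanish.
  filter_upwards [Measure.ae_ne volume (0 : ℝ)] with ξ hξ
  have hφ1 : φ 1 ≠ 0 := right_ne_zero_of_mul_eq_one (hκ.laplace 1 one_pos)
  have hchar : ∀ n, charFourier (F n) ξ = (bernsteinExt nuBar (θ n + Complex.I * ξ))⁻¹ *
      ((Complex.exp (Complex.I * b * ξ) - Complex.exp (Complex.I * a * ξ)) /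
        (Complex.I * ξ)) := by
    intro n
    rw [charFourier_convolution hIint (hkint n), charFourier_indicator_Ioo hab hξ,
      charFourier_dampedKernel_neg,
      eq_inv_of_mul_eq_one_left (hκ.laplace_mul_bernsteinExt hφ (by simpa using hθ n)), mul_comm]
  simp only [hchar]
  exact ((hφ.tendsto_bernsteinExt (fun n => (hθ n).le) hθlim ξ).inv₀
    (hφ.bernsteinExt_I_mul_ne_zero one_pos hφ1 hξ)).mul_const _

end

theorem mainTheorem10 (φ nuBar κ : ℝ → ℝ)
    (hφ : IsCompleteBernstein φ nuBar)
    (hκ : IsSonineKernel φ κ)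
    (hB1 : ∀ ε : ℝ, 0 < ε → MemLp κ 1 (volume.restrict (Ioo 0 ε)) ∧
      MemLp κ 2 (volume.restrict (Ioi ε)))
    (hB2 : ∀ ε : ℝ, 0 < ε → MemLp (kernelPrimitive κ) 2 (volume.restrict (Ioo 0 ε)))
    (a b : ℝ) (hab : a < b) :
    (∀ᵐ x : ℝ,
      IntegrableOn (fun t => (Ioo a b).indicator (fun _ => (1 : ℝ)) t * κ (t - x)) (Ioi x) ∧
      fracIntegral κ ((Ioo a b).indicator (fun _ => (1 : ℝ))) x =
        kernelPrimitive κ (max (b - x) 0) - kernelPrimitive κ (max (a - x) 0)) ∧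
    IsDistribFourier
      (fun x => (fracIntegral κ ((Ioo a b).indicator (fun _ => (1 : ℝ))) x : ℂ))
      (fun ξ => (bernsteinExt nuBar (Complex.I * ξ))⁻¹ *
        ((Complex.exp (Complex.I * b * ξ) - Complex.exp (Complex.I * a * ξ)) /
          (Complex.I * ξ))) ∧
    MemLp (fracIntegral κ ((Ioo a b).indicator (fun _ => (1 : ℝ)))) 2 volume := by
  have h1 : ∀ ε : ℝ, 0 < ε → IntegrableOn κ (Ioo 0 ε) := fun ε hε =>
    memLp_one_iff_integrable.1 (hB1 ε hε).1
  have h2 := (hB1 1 one_pos).2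
  refine ⟨ae_of_all _ fun x => ⟨?_, fracIntegral_indicator_Ioo h1 hab.le x⟩,
    isDistribFourier_fracIntegral hφ hκ h1 h2 hab.le, memLp_two_fracIntegral h1 h2 hab.le⟩
  rw [← integrable_indicator_iff measurableSet_Ioi, indicator_Ioi_shift]
  exact integrable_indicator_mul_zeroExtend h1 hab.le x
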